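/- **Setting.** For a positive semidefinite (psd) matrix $M\in\mathbb{C}^{N\times N}$ and a set $S\subseteq\{1,\dots,N\}$ write $$M/S := M - M(:,S)\,M(S,S)^{\dagger}\,M(S,:),$$ where $\dagger$ is the Moore–Penrose pseudoinverse. One *round with $b$ proposals* applied to $M$ is the following random step. If $\operatorname{tr} M=0$ (that is, $M=0$), the matrix is left unchanged. Otherwise draw $s_1',\dots,s_b'$ independently with $\mathbb{P}\{s_\ell'=j\}=M(j,j)/\operatorname{tr}M$, and replace $M$ by the residual $M/S$, where * for *block RPCholesky*, $S=\{s_1',\dots,s_b'\}$; * for *accelerated RPCholesky*, $S$ is obtained by rejection sampling: start with $S=\emptyset$ and, for $\ell=1,\dots,b$ in turn, replace $S$ by $S\cup\{s_\ell'\}$ with conditional probability $(M/S)(s_\ell',s_\ell')\,/\,M(s_\ell',s_\ell')$ (independent fresh randomness at each step), and otherwise leave $S$ unchanged. **Lemma (Central error bound).** Let $b\ge 1$, $t\ge 0$, let $A\in\mathbb{C}^{N\times N}$ be psd, and let $A^{(t)}$ be the random residual obtained from $A^{(0)}=A$ by $t$ successive rounds with $b$ proposals each, using fresh randomness in each round,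 of either accelerated or block RPCholesky. For $\alpha > 0$ put $\phi_\alpha(X)=X-\tfrac1\alpha X^2$, put $\phi_0(0)=0$, and for psd $M$ let $$\Phi_b(M)=\underbrace{\phi_{\operatorname{tr}M}\circ\cdots\circ\phi_{\operatorname{tr}M}}_{b\text{ times}}(M),$$ and let $\Phi_b^{(t)}$ be the $t$-fold composition of $\Phi_b$. Then $\mathbb{E}[A^{(t)}]$ and $\Phi_b^{(t)}(A)$ are psd and, with $\lambda_i$ denoting the $i$th largest eigenvalue (counted with multiplicity), $$\lambda_i\bigl(\mathbb{E}[A^{(t)}]\bigr)\le\lambda_i\bigl(\Phi_b^{(t)}(A)\bigr)\qquad\text{for each } i=1,\dots,N.$$ Consequently $\mathbb{E}\operatorname{tr}(A^{(t)})\le\operatorname{tr}\bigl(\Phi_b^{(t)}(A)\bigr)$. -/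

import Mathlib

open scoped ENNReal ComplexOrder

noncomputable section

namespace RPCholesky

/-! ### The Moore–Penrose pseudoinverse -/

/-- The four Penrose equations: `X` is the Moore–Penrose pseudoinverse of `F`. -/
structure IsMoorePenrose {m n : Type} [Fintype m] [Fintype n]
    (F : Matrix m n ℂ) (X : Matrix n m ℂ) : Prop where
  mul_mul_self : F * X * F = F
  mul_self_mul : X * F * X = X
  left_hermitian : (F * X).IsHermitian
  right_hermitian : (X * F).IsHermitian

theorem IsMoorePenrose.unique {m n : Type} [Fintype m] [Fintype n]
    {F : Matrix m n ℂ} {X Y : Matrix n m ℂ}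
    (hX : IsMoorePenrose F X) (hY : IsMoorePenrose F Y) : X = Y := by
  have h1 : F * X = F * Y := by
    have e : (F * Y) * (F * X) = F * X := by
      rw [← Matrix.mul_assoc, hY.mul_mul_self]
    have e' : (F * X) * (F * Y) = F * Y := by
      rw [← Matrix.mul_assoc, hX.mul_mul_self]
    have := congrArg Matrix.conjTranspose e
    rw [Matrix.conjTranspose_mul, hX.left_hermitian.eq, hY.left_hermitian.eq, e'] at this
    exact this.symm
  have h2 : X * F = Y * F := by
    have e : (X * F) * (Y * F) = X * F := by
      rw [Matrix.mul_assoc, ← Matrix.mul_assoc F, hY.mul_mul_self]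
    have e' : (Y * F) * (X * F) = Y * F := by
      rw [Matrix.mul_assoc, ← Matrix.mul_assoc F, hX.mul_mul_self]
    have := congrArg Matrix.conjTranspose e
    rw [Matrix.conjTranspose_mul, hX.right_hermitian.eq, hY.right_hermitian.eq, e'] at this
    exact this.symm
  calc X = X * F * X := hX.mul_self_mul.symm
    _ = Y * F * X := by rw [h2]
    _ = Y * (F * X) := Matrix.mul_assoc _ _ _
    _ = Y * F * Y := by rw [h1, Matrix.mul_assoc]
    _ = Y := hY.mul_self_mul

theorem exists_isMoorePenrose {m n : Type} [Fintype m] [Fintype n] [DecidableEq n]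
    (F : Matrix m n ℂ) : ∃ X, IsMoorePenrose F X := by
  set H : Matrix n n ℂ := F.conjTranspose * F with hH
  have hHsa : IsSelfAdjoint H := Matrix.isHermitian_conjTranspose_mul_self F
  set G : Matrix n n ℂ := cfc (fun x : ℝ => x⁻¹) H with hG
  have hGh : G.conjTranspose = G := (cfc_predicate (fun x : ℝ => x⁻¹) H : IsSelfAdjoint _)
  have hHh : H.conjTranspose = H := hHsa
  have cont : ∀ f : ℝ → ℝ, ContinuousOn f (spectrum ℝ H) := fun f =>
    (Matrix.finite_real_spectrum (A := H)).continuousOn f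
  have hid : cfc (fun x : ℝ => x) H = H := cfc_id' ℝ H
  have hcomm : G * H = H * G := by
    conv_lhs => rw [← hid]
    conv_rhs => rw [← hid]
    rw [hid, hG]
    nth_rewrite 2 [← hid]
    nth_rewrite 3 [← hid]
    rw [← cfc_mul _ _ H (cont _) (cont _), ← cfc_mul _ _ H (cont _) (cont _)]
    simp only [mul_comm]
  have hHG : H * G = cfc (fun x : ℝ => x * x⁻¹) H := by
    rw [cfc_mul _ _ H (cont _) (cont _), hid]
  have hHGH : H * G * H = H := by
    rw [hHG]
    nth_rewrite 2 [← hid]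
    rw [← cfc_mul _ _ H (cont _) (cont _)]
    simp only [mul_inv_mul_cancel]
    exact hid
  have hGHG : G * H * G = G := by
    rw [Matrix.mul_assoc, hHG, hG, ← cfc_mul _ _ H (cont _) (cont _)]
    congr 1
    funext x
    by_cases hx : x = 0 <;> simp [hx]
  have hz : F - F * (G * H) = 0 := by
    rw [← Matrix.conjTranspose_mul_self_eq_zero]
    have : (F - F * (G * H)).conjTranspose * (F - F * (G * H))
        = H - H * G * H - (H * G * H - H * G * (H * G * H)) := by
      rw [Matrix.conjTranspose_sub, Matrix.conjTranspose_mul, Matrix.conjTranspose_mul, hGh, hHh,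
        Matrix.sub_mul, Matrix.mul_sub, Matrix.mul_sub, ← Matrix.mul_assoc, ← hH]
      simp only [Matrix.mul_assoc, ← hH]
      rw [← Matrix.mul_assoc F.conjTranspose, ← hH]
    rw [this, hHGH, hHGH]
    simp
  refine ⟨G * F.conjTranspose, ⟨?_, ?_, ?_, ?_⟩⟩
  · rw [Matrix.mul_assoc, Matrix.mul_assoc, ← hH]
    exact (sub_eq_zero.mp hz).symm
  · rw [Matrix.mul_assoc G, ← hH, ← Matrix.mul_assoc, hGHG]
  · rw [Matrix.IsHermitian, Matrix.conjTranspose_mul, Matrix.conjTranspose_mul, hGh,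
      Matrix.conjTranspose_conjTranspose, Matrix.mul_assoc]
  · rw [Matrix.mul_assoc, ← hH, Matrix.IsHermitian, Matrix.conjTranspose_mul, hGh, hHh, hcomm]

/-- The Moore–Penrose pseudoinverse of a complex matrix. -/
def pinv {m n : Type} [Fintype m] [Fintype n] [DecidableEq n]
    (F : Matrix m n ℂ) : Matrix n m ℂ :=
  (exists_isMoorePenrose F).choose

theorem pinv_spec {m n : Type} [Fintype m] [Fintype n] [DecidableEq n]
    (F : Matrix m n ℂ) : IsMoorePenrose F (pinv F) :=
  (exists_isMoorePenrose F).choose_spec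

/-! ### The algorithms -/

/-- The residual `M - M(:,S) M(S,S)† M(S,:)` after eliminating the pivots in `S`. -/
def pivotResidual {N : ℕ} (M : Matrix (Fin N) (Fin N) ℂ) (S : Finset (Fin N)) :
    Matrix (Fin N) (Fin N) ℂ :=
  M - M.submatrix id (fun j : S => (j : Fin N)) *
      pinv (M.submatrix (fun j : S => (j : Fin N)) (fun j : S => (j : Fin N))) *
      M.submatrix (fun j : S => (j : Fin N)) id

/-- The unnormalized proposal weights: the diagonal of `M`. -/
def diagWeight {N : ℕ} (M : Matrix (Fin N) (Fin N) ℂ) (j : Fin N) : ℝ≥0∞ :=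
  ENNReal.ofReal (M j j).re

theorem tsum_diagWeight_ne_top {N : ℕ} (M : Matrix (Fin N) (Fin N) ℂ) :
    ∑' j, diagWeight M j ≠ ∞ := by
  rw [tsum_fintype]
  exact ENNReal.sum_ne_top.mpr fun j _ => ENNReal.ofReal_ne_top

/-- The proposal distribution `ℙ{s = j} = M(j,j) / tr M`, for a psd `M` of nonzero trace. -/
def proposal {N : ℕ} (M : Matrix (Fin N) (Fin N) ℂ) (h : ∑' j, diagWeight M j ≠ 0) :
    PMF (Fin N) :=
  PMF.normalize (diagWeight M) h (tsum_diagWeight_ne_top M)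

/-- `b` independent draws from `p`. -/
def iidDraws {α : Type} (p : PMF α) : ℕ → PMF (List α)
  | 0 => PMF.pure []
  | b + 1 => p.bind fun a => (iidDraws p b).map fun l => a :: l

/-- The probability of accepting the proposal `s` when the pivots in `S` have been accepted:
`(M(s,s) - M(s,S) M(S,S)† M(S,s)) / M(s,s)`. (For psd `M` this ratio lies in `[0,1]`
and the truncation has no effect.) -/
def acceptProb {N : ℕ} (M : Matrix (Fin N) (Fin N) ℂ) (S : Finset (Fin N)) (s : Fin N) : ℝ≥0∞ :=
  min 1 (ENNReal.ofReal ((pivotResidual M S s s).re / (M s s).re))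

/-- A coin showing `true` with probability `acceptProb M S s`. -/
def acceptCoin {N : ℕ} (M : Matrix (Fin N) (Fin N) ℂ) (S : Finset (Fin N)) (s : Fin N) :
    PMF Bool :=
  PMF.ofFintype (fun a => if a then acceptProb M S s else 1 - acceptProb M S s) (by
    simp only [Fintype.sum_bool, if_true, Bool.false_eq_true, if_false]
    exact add_tsub_cancel_of_le (min_le_left _ _))

/-- Rejection sampling: go through the list of proposals, accept each of them with probability
`acceptProb` given the set of pivots accepted so far, and return the final set. -/
def rejectionSample {N : ℕ} (M : Matrix (Fin N) (Fin N) ℂ) :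
    List (Fin N) → Finset (Fin N) → PMF (Finset (Fin N))
  | [], S => PMF.pure S
  | s :: l, S => (acceptCoin M S s).bind fun a =>
      rejectionSample M l (if a then insert s S else S)

/-- The two algorithms. -/
inductive Method where
  | block
  | accelerated

/-- The random set of pivots used in a round, given the list of proposals: block RPCholesky takes
all of them, accelerated RPCholesky thins them by rejection sampling. -/
def selectPivots {N : ℕ} (μ : Method) (M : Matrix (Fin N) (Fin N) ℂ) (l : List (Fin N)) :
    PMF (Finset (Fin N)) :=
  match μ with
  | .block => PMF.pure l.toFinset
  | .accelerated => rejectionSample M l ∅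

/-- The law of the residual after one round with `b` proposals, started from `M`. If the trace
of the psd matrix `M` is zero (that is, `M = 0`), there is nothing to sample and `M` is kept. -/
def roundLaw {N : ℕ} (μ : Method) (b : ℕ) (M : Matrix (Fin N) (Fin N) ℂ) :
    PMF (Matrix (Fin N) (Fin N) ℂ) :=
  if h : ∑' j, diagWeight M j = 0 then PMF.pure M
  else ((iidDraws (proposal M h) b).bind (selectPivots μ M)).map (pivotResidual M)

/-- The law of the residual `A^(t)` after `t` rounds with `b` proposals each, started from `A`. -/
def residualLaw {N : ℕ} (μ : Method) (b : ℕ) (A : Matrix (Fin N) (Fin N) ℂ) :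
    ℕ → PMF (Matrix (Fin N) (Fin N) ℂ)
  | 0 => PMF.pure A
  | t + 1 => (residualLaw μ b A t).bind (roundLaw μ b)

/-- The expectation `𝔼 f(X)` for `X` with law `p`. It is only used for the laws
`residualLaw μ b A t`, whose supports are finite, so the sum is a finite one. -/
def expectation {α E : Type} [AddCommMonoid E] [TopologicalSpace E] [Module ℝ E]
    (p : PMF α) (f : α → E) : E :=
  ∑' a, (p a).toReal • f a

theorem support_bind_finite {α β : Type} {p : PMF α} {f : α → PMF β}
    (hp : p.support.Finite) (hf : ∀ a, (f a).support.Finite) : (p.bind f).support.Finite := by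
  rw [PMF.support_bind]
  exact hp.biUnion fun a _ => hf a

theorem iidDraws_support_finite {α : Type} [Finite α] (p : PMF α) (b : ℕ) :
    (iidDraws p b).support.Finite := by
  induction b with
  | zero => simp [iidDraws]
  | succ b ih =>
    refine support_bind_finite (Set.toFinite _) fun a => ?_
    rw [PMF.support_map]
    exact ih.image _

theorem residualLaw_support_finite {N : ℕ} (μ : Method) (b : ℕ) (A : Matrix (Fin N) (Fin N) ℂ)
    (t : ℕ) : (residualLaw μ b A t).support.Finite := by
  induction t with
  | zero => simp [residualLaw]
  | succ t ih =>
    refine support_bind_finite ih fun M => ?_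
    unfold roundLaw
    split
    · simp
    · rw [PMF.support_map]
      exact (support_bind_finite (iidDraws_support_finite _ _) fun _ => Set.toFinite _).image _

/-! ### The expected residual function and eigenvalues -/

/-- `φ_α(X) = X - X² / α`. (For `α = 0` this is `X`; it is then only applied to `X = 0`.) -/
def phi {N : ℕ} (α : ℂ) (X : Matrix (Fin N) (Fin N) ℂ) : Matrix (Fin N) (Fin N) ℂ :=
  X - (1 / α) • X ^ 2

/-- `Φ_b(M)`, the `b`-fold composition of `φ_{tr M}` applied to `M`. -/
def Phi {N : ℕ} (b : ℕ) (M : Matrix (Fin N) (Fin N) ℂ) : Matrix (Fin N) (Fin N) ℂ :=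
  (phi M.trace)^[b] M

/-- The `i`-th largest eigenvalue, with multiplicity; `i` starts from `0`. -/
def orderedEigenvalue {N : ℕ} {M : Matrix (Fin N) (Fin N) ℂ} (hM : M.IsHermitian) (i : Fin N) :
    ℝ :=
  hM.eigenvalues₀ (Fin.cast (Fintype.card_fin N).symm i)

end RPCholesky

end

/-!
The proof compares expected residuals with the recursion `Φ` step by step, where a step is the
treatment of a single proposal.

*One step.* Eliminating a further pivot `s` from the residual `R = M / S` subtracts the rank-one
matrix `R e_s e_s⋆ R / R(s, s)` (`pivotResidual_insert`). This follows from a description of `M / S`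
that does not involve the pseudoinverse: it is the only matrix `M - M W`, with `W` supported on the
rows in `S`, whose rows in `S` vanish (`IsResidual`). A proposal `s` is drawn and accepted with
probability at least `R(s, s) / tr M`, with equality for accelerated RPCholesky, so that the expected
residual after the step is at most `R - R² / tr M` (`expectation_pivotStep_le`).

*One round.* The map `(α, X) ↦ X - X² / α` is jointly concave (`sum_smul_phi_le`). Hence the
unconditional expectations `X_k` of the residual after `k` steps of a round satisfy
`X_{k+1} ≤ X_k - X_k² / α` with `α = tr X_0`; here `α` is the expectation of the random traces
`tr M`. Now `X ↦ X - X² / α` does not respect the Loewner order, but `x ↦ x - x² / α` is increasing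
up to `α / 2`, and a single application brings all its values below `α / 4`. By Weyl's monotonicity
principle (`eigenvalues_le_of_le`) the ordered eigenvalues of `X_b` are thus at most those of
`Φ_b(X_0)` (`eigenvalues_le_eigenvalues_Phi`).

*All rounds.* `Φ_b` respects the comparison of ordered eigenvalues
(`eigenvalues_Phi_le_eigenvalues_Phi`). This reduces to numbers: the first application of
`x ↦ x - x² / α` is controlled by superadditivity in `(α, x)`, the later ones by monotonicity as
above. Induction on the number of rounds concludes.

Ordered eigenvalues are compared through `Matrix.IsHermitian.eigenvalues`, which lists them in
decreasing order with respect to a fixed enumeration of the indices.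
-/

noncomputable section

namespace RPCholesky

open scoped MatrixOrder
open Matrix Unitary

/-! ### Comparison of eigenvalues -/

section Eigenvalues

variable {n : Type*} [Fintype n] [DecidableEq n]

/-- The quadratic form of `U diag(a) U⋆` in the coordinates of the columns of `U`. -/
theorem star_dotProduct_conj_diagonal_mulVec (U : unitaryGroup n ℂ) (a : n → ℝ) (x : n → ℂ) :
    star x ⬝ᵥ (conjStarAlgAut ℂ _ U (diagonal (RCLike.ofReal ∘ a)) *ᵥ x)
      = ((∑ j, a j * ‖(star (U : Matrix n n ℂ) *ᵥ x) j‖ ^ 2 : ℝ) : ℂ) := by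
  set y := star (U : Matrix n n ℂ) *ᵥ x with hy
  have h1 : star x ᵥ* (U : Matrix n n ℂ) = star y := by
    rw [hy, star_mulVec, star_eq_conjTranspose, conjTranspose_conjTranspose]
  rw [conjStarAlgAut_apply, ← mulVec_mulVec, ← mulVec_mulVec, dotProduct_mulVec, h1, ← hy]
  simp only [dotProduct, mulVec_diagonal, Pi.star_apply, Function.comp_apply]
  push_cast
  refine Finset.sum_congr rfl fun j _ => ?_
  rw [mul_left_comm, ← Complex.conj_mul']
  rfl

theorem sum_norm_sq_star_unitary_mulVec (U : unitaryGroup n ℂ) (x : n → ℂ) :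
    ((∑ j, ‖(star (U : Matrix n n ℂ) *ᵥ x) j‖ ^ 2 : ℝ) : ℂ) = star x ⬝ᵥ x := by
  have := star_dotProduct_conj_diagonal_mulVec U (fun _ => 1) x
  have h1 : (diagonal (RCLike.ofReal ∘ fun _ : n => (1 : ℝ)) : Matrix n n ℂ) = 1 := by
    ext i j; simp [diagonal_apply, one_apply]
  rw [h1, map_one, one_mulVec] at this
  rw [this]; simp

/-- The min-max argument: a space of dimension `S.card` spanned by eigenvectors of the smaller
matrix contains a nonzero vector orthogonal to `T.card` given eigenvectors of the larger one. -/
theorem exists_le_of_conj_diagonal_le {U V : unitaryGroup n ℂ} {a b : n → ℝ}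
    (h : conjStarAlgAut ℂ _ U (diagonal (RCLike.ofReal ∘ a))
      ≤ conjStarAlgAut ℂ _ V (diagonal (RCLike.ofReal ∘ b)))
    {S T : Finset n} (hST : T.card < S.card) : ∃ j ∈ S, ∃ k ∉ T, a j ≤ b k := by
  by_contra! hab
  set F : Matrix T S ℂ :=
    (star (V : Matrix n n ℂ) * U).submatrix (fun k => (k : n)) (fun j => (j : n)) with hF
  have hker : LinearMap.ker F.mulVecLin ≠ ⊥ :=
    LinearMap.ker_ne_bot_of_finrank_lt (by simpa using hST)
  obtain ⟨c, hc, hc0⟩ := (Submodule.ne_bot_iff _).mp hker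
  set y : n → ℂ := fun j => if hj : j ∈ S then c ⟨j, hj⟩ else 0 with hy
  have hyS : ∀ j ∉ S, y j = 0 := fun j hj => by simp [hy, hj]
  set x := (U : Matrix n n ℂ) *ᵥ y with hx
  have hUx : star (U : Matrix n n ℂ) *ᵥ x = y := by
    rw [hx, mulVec_mulVec, Unitary.coe_star_mul_self, one_mulVec]
  set z := star (V : Matrix n n ℂ) *ᵥ x with hz
  have hzT : ∀ k ∈ T, z k = 0 := by
    intro k hk
    have h1 : (F *ᵥ c) ⟨k, hk⟩ = 0 := congrFun (LinearMap.mem_ker.mp hc) ⟨k, hk⟩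
    rw [← h1, hz, hx, mulVec_mulVec]
    simp only [mulVec, dotProduct, hF, submatrix_apply]
    rw [← Finset.sum_subset S.subset_univ fun j _ hj => by rw [hyS j hj, mul_zero],
      ← Finset.sum_coe_sort]
    exact Finset.sum_congr rfl fun j _ => by simp [hy]
  have hsum : ∑ j, ‖y j‖ ^ 2 = ∑ k, ‖z k‖ ^ 2 := by
    have h1 := sum_norm_sq_star_unitary_mulVec U x
    have h2 := sum_norm_sq_star_unitary_mulVec V x
    rw [hUx] at h1
    rw [← hz] at h2
    exact_mod_cast h1.trans h2.symm
  have hle : ∑ j, a j * ‖y j‖ ^ 2 ≤ ∑ k, b k * ‖z k‖ ^ 2 := by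
    have h1 := (le_iff.mp h).dotProduct_mulVec_nonneg x
    rw [sub_mulVec, dotProduct_sub, star_dotProduct_conj_diagonal_mulVec,
      star_dotProduct_conj_diagonal_mulVec, hUx, ← hz, sub_nonneg] at h1
    exact_mod_cast h1
  have hpos : 0 < ∑ j, ‖y j‖ ^ 2 := by
    obtain ⟨j, hj⟩ := Function.ne_iff.mp hc0
    refine Finset.sum_pos' (fun _ _ => by positivity) ⟨j, Finset.mem_univ _, ?_⟩
    have : y j = c j := by simp [hy]
    rw [this]
    have : 0 < ‖c j‖ := norm_pos_iff.mpr hj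
    positivity
  -- `m` separates the eigenvalues `a j` from the eigenvalues `b k`.
  obtain ⟨j₀, hj₀, hmin⟩ := S.exists_min_image a (Finset.card_pos.mp (by omega))
  set m := a j₀
  have h1 : m * ∑ j, ‖y j‖ ^ 2 ≤ ∑ j, a j * ‖y j‖ ^ 2 := by
    rw [Finset.mul_sum]
    refine Finset.sum_le_sum fun j _ => ?_
    by_cases hj : j ∈ S
    · exact mul_le_mul_of_nonneg_right (hmin j hj) (by positivity)
    · simp [hyS j hj]
  have h2 : ∑ k, b k * ‖z k‖ ^ 2 < m * ∑ k, ‖z k‖ ^ 2 := by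
    rw [Finset.mul_sum]
    have hk : ∃ k, z k ≠ 0 := by
      by_contra! hall
      rw [hsum] at hpos
      simp [hall] at hpos
    obtain ⟨k, hk⟩ := hk
    have hlt : ∀ k, z k ≠ 0 → b k < m := fun k hk =>
      hab j₀ hj₀ k fun hT => hk (hzT k hT)
    refine Finset.sum_lt_sum (fun k _ => ?_) ⟨k, Finset.mem_univ _, ?_⟩
    · by_cases h0 : z k = 0
      · simp [h0]
      · exact mul_le_mul_of_nonneg_right (hlt k h0).le (by positivity)
    · have : 0 < ‖z k‖ := norm_pos_iff.mpr hk
      exact mul_lt_mul_of_pos_right (hlt k hk) (by positivity)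
  rw [hsum] at h1
  linarith

/-- **Weyl's monotonicity principle.** -/
theorem eigenvalues_le_of_le {X Y : Matrix n n ℂ} (hX : X.IsHermitian) (hY : Y.IsHermitian)
    (h : X ≤ Y) : hX.eigenvalues ≤ hY.eigenvalues := by
  intro i
  set e := (Fintype.equivOfCardEq (Fintype.card_fin (Fintype.card n)) : _ ≃ n)
  rw [hX.spectral_theorem, hY.spectral_theorem] at h
  obtain ⟨j, hj, k, hk, hjk⟩ := exists_le_of_conj_diagonal_le h
    (S := (Finset.Iic (e.symm i)).map e.toEmbedding)
    (T := (Finset.Iio (e.symm i)).map e.toEmbedding) (by simp)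
  have hj' : e.symm j ≤ e.symm i := by simpa using hj
  have hk' : e.symm i ≤ e.symm k := by simpa using hk
  exact (hX.eigenvalues₀_antitone hj').trans (hjk.trans (hY.eigenvalues₀_antitone hk'))

theorem charpoly_conj (U : unitaryGroup n ℂ) (X : Matrix n n ℂ) :
    (conjStarAlgAut ℂ _ U X).charpoly = X.charpoly := by
  rw [conjStarAlgAut_apply, charpoly_mul_comm, ← mul_assoc, Unitary.coe_star_mul_self, one_mul]

theorem isHermitian_conj_diagonal (U : unitaryGroup n ℂ) (a : n → ℝ) :
    (conjStarAlgAut ℂ _ U (diagonal (RCLike.ofReal ∘ a)) : Matrix n n ℂ).IsHermitian := by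
  have h : IsSelfAdjoint (diagonal (RCLike.ofReal ∘ a) : Matrix n n ℂ) := by
    rw [isSelfAdjoint_iff, star_eq_conjTranspose, diagonal_conjTranspose]
    congr 1
    funext i
    simp
  exact h.map (conjStarAlgAut ℂ _ U)

theorem conj_diagonal_le {U : unitaryGroup n ℂ} {a b : n → ℝ} (h : a ≤ b) :
    conjStarAlgAut ℂ _ U (diagonal (RCLike.ofReal ∘ a) : Matrix n n ℂ)
      ≤ conjStarAlgAut ℂ _ U (diagonal (RCLike.ofReal ∘ b)) := by
  rw [le_iff, ← map_sub, diagonal_sub, conjStarAlgAut_apply, star_eq_conjTranspose]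
  refine PosSemidef.mul_mul_conjTranspose_same (PosSemidef.diagonal fun i => ?_) _
  simpa using h i

/-- The listing of the eigenvalues in decreasing order respects entrywise comparison of arbitrary
listings. -/
theorem eigenvalues_le_of_eq_conj_diagonal {X Y : Matrix n n ℂ} (hX : X.IsHermitian)
    (hY : Y.IsHermitian) {U V : unitaryGroup n ℂ} {a b : n → ℝ}
    (hXa : X = conjStarAlgAut ℂ _ U (diagonal (RCLike.ofReal ∘ a)))
    (hYb : Y = conjStarAlgAut ℂ _ V (diagonal (RCLike.ofReal ∘ b))) (hab : a ≤ b) :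
    hX.eigenvalues ≤ hY.eigenvalues := by
  have hZ := isHermitian_conj_diagonal U b
  have h1 : hX.eigenvalues ≤ hZ.eigenvalues :=
    eigenvalues_le_of_le hX hZ (hXa ▸ conj_diagonal_le hab)
  have h2 : hZ.eigenvalues = hY.eigenvalues := by
    rw [IsHermitian.eigenvalues_eq_eigenvalues_iff, hYb, charpoly_conj, charpoly_conj]
  rwa [h2] at h1

end Eigenvalues

/-! ### The expected residual function -/

section Phi

/-- The action of `phi α` on eigenvalues, `x ↦ x - x² / α`. As for `phi`, the value at `α = 0` is
the identity. -/
def phiReal (α x : ℝ) : ℝ := x - 1 / α * x ^ 2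

theorem phiReal_zero (x : ℝ) : phiReal 0 x = x := by simp [phiReal]

theorem phiReal_nonneg {α x : ℝ} (hx : 0 ≤ x) (hα : x ≤ α) : 0 ≤ phiReal α x := by
  rcases hx.eq_or_lt with rfl | h
  · simp [phiReal]
  · have : 0 < α := h.trans_le hα
    rw [phiReal, one_div_mul_eq_div, sub_nonneg, div_le_iff₀ this]
    nlinarith

theorem phiReal_le {α x : ℝ} (hα : 0 ≤ α) : phiReal α x ≤ x := by
  have : 0 ≤ 1 / α * x ^ 2 := by positivity
  rw [phiReal]; linarith

theorem phiReal_le_quarter {α : ℝ} (hα : 0 < α) (x : ℝ) : phiReal α x ≤ α / 4 := by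
  have h : α / 4 - phiReal α x = (x - α / 2) ^ 2 / α := by
    rw [phiReal]; field_simp; ring
  have : 0 ≤ (x - α / 2) ^ 2 / α := by positivity
  linarith

theorem phiReal_mono_of_le_half {α x y : ℝ} (hα : 0 < α) (hxy : x ≤ y) (hy : y ≤ α / 2) :
    phiReal α x ≤ phiReal α y := by
  have h : phiReal α y - phiReal α x = (y - x) * (α - x - y) / α := by
    rw [phiReal, phiReal]; field_simp; ring
  have : 0 ≤ (y - x) * (α - x - y) / α :=
    div_nonneg (mul_nonneg (by linarith) (by linarith)) hα.le
  linarith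

/-- Superadditivity of `(α, x) ↦ x - x² / α`, with the increment of `x` at most that of `α`. -/
theorem phiReal_le_phiReal_of_sub_le {α β x y : ℝ} (hx : 0 ≤ x) (hxy : x ≤ y) (hxα : x ≤ α)
    (h : y - x ≤ β - α) : phiReal α x ≤ phiReal β y := by
  rcases (hx.trans hxα).eq_or_lt with rfl | hα
  · obtain rfl : x = 0 := le_antisymm hxα hx
    rw [phiReal_zero]
    exact phiReal_nonneg hxy (by linarith)
  · have hβ : 0 < β := by linarith
    rw [phiReal, phiReal, ← sub_nonneg]
    have : y - 1 / β * y ^ 2 - (x - 1 / α * x ^ 2)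
        = (α * β * (y - x) + β * x ^ 2 - α * y ^ 2) / (α * β) := by
      field_simp
      ring
    rw [this]
    refine div_nonneg ?_ (by positivity)
    -- with `y = x + d` and `β ≥ α + d` the numerator is at least `d (x - α)²`
    nlinarith [mul_nonneg (sub_nonneg.mpr hxy) (sq_nonneg (x - α)),
      mul_nonneg (sub_nonneg.mpr h) (add_nonneg (mul_nonneg hα.le (sub_nonneg.mpr hxy))
        (sq_nonneg x))]

theorem iterate_phiReal_mem {α x : ℝ} (hx : 0 ≤ x) (hα : x ≤ α) (b : ℕ) :
    0 ≤ (phiReal α)^[b] x ∧ (phiReal α)^[b] x ≤ α := by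
  induction b with
  | zero => exact ⟨hx, hα⟩
  | succ b ih =>
    rw [Function.iterate_succ_apply']
    exact ⟨phiReal_nonneg ih.1 ih.2, (phiReal_le (hx.trans hα)).trans ih.2⟩

/-- The `b`-fold composition respects the order, where the parameter grows at least as much as the
argument: after a first step all values are at most a quarter of the parameter, and `phiReal β` is
increasing up to `β / 2`. -/
theorem iterate_phiReal_le_iterate_phiReal {α β x y : ℝ} (hx : 0 ≤ x) (hxy : x ≤ y) (hxα : x ≤ α)
    (h : y - x ≤ β - α) (b : ℕ) : (phiReal α)^[b] x ≤ (phiReal β)^[b] y := by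
  rcases (hx.trans hxα).eq_or_lt with rfl | hα
  · obtain rfl : x = 0 := le_antisymm hxα hx
    rw [Function.iterate_fixed (phiReal_zero 0)]
    exact (iterate_phiReal_mem hxy (by linarith) b).1
  have hβ : 0 < β := by linarith
  induction b with
  | zero => exact hxy
  | succ b ih =>
    rw [Function.iterate_succ_apply', Function.iterate_succ_apply']
    cases b with
    | zero => exact phiReal_le_phiReal_of_sub_le hx hxy hxα h
    | succ b =>
      set u := (phiReal α)^[b + 1] x
      set v := (phiReal β)^[b + 1] y with hv
      have hv4 : v ≤ β / 4 := by
        rw [hv, Function.iterate_succ_apply']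
        exact phiReal_le_quarter hβ _
      calc phiReal α u ≤ phiReal β u := by
            have : 1 / β ≤ 1 / α := one_div_le_one_div_of_le hα (by linarith)
            rw [phiReal, phiReal]
            nlinarith [mul_le_mul_of_nonneg_right this (sq_nonneg u)]
        _ ≤ phiReal β v := phiReal_mono_of_le_half hβ ih (by linarith)

variable {N : ℕ}

theorem phi_conj_diagonal (α : ℝ) (U : unitaryGroup (Fin N) ℂ) (a : Fin N → ℝ) :
    phi (α : ℂ) (conjStarAlgAut ℂ _ U (diagonal (RCLike.ofReal ∘ a)))
      = conjStarAlgAut ℂ _ U (diagonal (RCLike.ofReal ∘ phiReal α ∘ a)) := by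
  rw [phi, ← map_pow, ← map_smul, ← map_sub, diagonal_pow, ← diagonal_smul, diagonal_sub]
  congr 2
  funext i
  simp [phiReal]

theorem iterate_phi_conj_diagonal (α : ℝ) (U : unitaryGroup (Fin N) ℂ) (a : Fin N → ℝ) (b : ℕ) :
    (phi (α : ℂ))^[b] (conjStarAlgAut ℂ _ U (diagonal (RCLike.ofReal ∘ a)))
      = conjStarAlgAut ℂ _ U (diagonal (RCLike.ofReal ∘ (phiReal α)^[b] ∘ a)) := by
  induction b with
  | zero => rfl
  | succ b ih =>
    rw [Function.iterate_succ_apply', ih, phi_conj_diagonal, Function.iterate_succ']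
    rfl

theorem trace_eq_ofReal_sum {M : Matrix (Fin N) (Fin N) ℂ} (hM : M.IsHermitian) :
    M.trace = ((∑ i, hM.eigenvalues i : ℝ) : ℂ) := by
  rw [hM.trace_eq_sum_eigenvalues]
  push_cast
  rfl

theorem Phi_eq_conj_diagonal {M : Matrix (Fin N) (Fin N) ℂ} (hM : M.IsHermitian) (b : ℕ) :
    Phi b M = conjStarAlgAut ℂ _ hM.eigenvectorUnitary
      (diagonal (RCLike.ofReal ∘ (phiReal (∑ i, hM.eigenvalues i))^[b] ∘ hM.eigenvalues)) := by
  rw [Phi, trace_eq_ofReal_sum hM]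
  conv_lhs => arg 3; rw [hM.spectral_theorem]
  exact iterate_phi_conj_diagonal _ _ _ _

theorem eigenvalues_le_sum {M : Matrix (Fin N) (Fin N) ℂ} (hM : M.PosSemidef)
    (i : Fin N) : hM.isHermitian.eigenvalues i ≤ ∑ j, hM.isHermitian.eigenvalues j :=
  Finset.single_le_sum (fun j _ => hM.eigenvalues_nonneg j) (Finset.mem_univ i)

theorem Phi_posSemidef {M : Matrix (Fin N) (Fin N) ℂ} (hM : M.PosSemidef) (b : ℕ) :
    (Phi b M).PosSemidef := by
  rw [Phi_eq_conj_diagonal hM.isHermitian, conjStarAlgAut_apply, star_eq_conjTranspose]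
  refine PosSemidef.mul_mul_conjTranspose_same (PosSemidef.diagonal fun i => ?_) _
  simpa using (iterate_phiReal_mem (hM.eigenvalues_nonneg i) (eigenvalues_le_sum hM i) b).1

theorem iterate_Phi_posSemidef {M : Matrix (Fin N) (Fin N) ℂ} (hM : M.PosSemidef) (b t : ℕ) :
    ((Phi b)^[t] M).PosSemidef := by
  induction t with
  | zero => exact hM
  | succ t ih =>
    rw [Function.iterate_succ_apply']
    exact Phi_posSemidef ih b

/-- `Phi b` respects the comparison of eigenvalues. -/
theorem eigenvalues_Phi_le_eigenvalues_Phi {X Y : Matrix (Fin N) (Fin N) ℂ} (hX : X.PosSemidef)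
    (hY : Y.PosSemidef) (h : hX.isHermitian.eigenvalues ≤ hY.isHermitian.eigenvalues) (b : ℕ) :
    (Phi_posSemidef hX b).isHermitian.eigenvalues
      ≤ (Phi_posSemidef hY b).isHermitian.eigenvalues := by
  refine eigenvalues_le_of_eq_conj_diagonal _ _ (Phi_eq_conj_diagonal hX.isHermitian b)
    (Phi_eq_conj_diagonal hY.isHermitian b) fun i => ?_
  refine iterate_phiReal_le_iterate_phiReal (hX.eigenvalues_nonneg i) (h i)
    (eigenvalues_le_sum hX i) ?_ b
  rw [← Finset.sum_sub_distrib]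
  exact Finset.single_le_sum (f := fun i => hY.isHermitian.eigenvalues i
    - hX.isHermitian.eigenvalues i) (fun j _ => sub_nonneg.mpr (h j)) (Finset.mem_univ i)

/-- A sequence that decreases at least as fast as the recursion `X (k + 1) = phi α (X k)` with
`α = tr (X 0)` is dominated by that recursion in terms of eigenvalues. -/
theorem eigenvalues_le_eigenvalues_Phi {X : ℕ → Matrix (Fin N) (Fin N) ℂ}
    (hX : ∀ k, (X k).IsHermitian) (h0 : (X 0).PosSemidef)
    (hstep : ∀ k, X (k + 1) ≤ phi (X 0).trace (X k)) (b : ℕ) :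
    (hX b).eigenvalues ≤ (Phi_posSemidef h0 b).isHermitian.eigenvalues := by
  set α := ∑ i, h0.isHermitian.eigenvalues i with hα
  have htr : (X 0).trace = (α : ℂ) := trace_eq_ofReal_sum h0.isHermitian
  have hα0 : 0 ≤ α := Finset.sum_nonneg fun i _ => h0.eigenvalues_nonneg i
  have hphi : ∀ {M : Matrix (Fin N) (Fin N) ℂ} (hM : M.IsHermitian), phi (X 0).trace M
      = conjStarAlgAut ℂ _ hM.eigenvectorUnitary
        (diagonal (RCLike.ofReal ∘ phiReal α ∘ hM.eigenvalues)) := fun {M} hM => by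
    rw [htr]
    conv_lhs => rw [hM.spectral_theorem]
    exact phi_conj_diagonal _ _ _
  induction b with
  | zero => exact le_rfl
  | succ b ih =>
    have hPhi : Phi (b + 1) (X 0) = phi (X 0).trace (Phi b (X 0)) :=
      Function.iterate_succ_apply' _ _ _
    have hH : (phi (X 0).trace (X b)).IsHermitian := by
      rw [hphi (hX b)]
      exact isHermitian_conj_diagonal _ _
    refine (eigenvalues_le_of_le (hX (b + 1)) hH (hstep b)).trans ?_
    cases b with
    | zero => exact le_rfl
    | succ b =>
      have hP := (Phi_posSemidef h0 (b + 1)).isHermitian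
      refine eigenvalues_le_of_eq_conj_diagonal _ _ (hphi (hX _)) (hPhi.trans (hphi hP))
        fun i => ?_
      rcases hα0.eq_or_lt with h | h
      · simp only [Function.comp_apply, ← h, phiReal_zero]
        exact ih i
      · refine phiReal_mono_of_le_half h (ih i) ?_
        have hQ := isHermitian_conj_diagonal (1 : unitaryGroup (Fin N) ℂ) fun _ => α / 4
        -- the eigenvalues of `phi α Z` are at most those of the scalar matrix `α / 4`
        have h4 : hP.eigenvalues ≤ hQ.eigenvalues :=
          eigenvalues_le_of_eq_conj_diagonal hP hQ
            ((Function.iterate_succ_apply' _ _ _).trans (hphi (Phi_posSemidef h0 b).isHermitian))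
            rfl fun j => phiReal_le_quarter h _
        have hQi : hQ.eigenvalues i = α / 4 := by
          have h1 := hQ.eigenvalues_mem_spectrum_real i
          have h2 : (conjStarAlgAut ℂ _ (1 : unitaryGroup (Fin N) ℂ) (diagonal
              (RCLike.ofReal ∘ fun _ => α / 4)) : Matrix (Fin N) (Fin N) ℂ)
              = algebraMap ℝ _ (α / 4) := by
            ext i j
            simp [diagonal_apply, algebraMap_matrix_apply]
          have : Nonempty (Fin N) := ⟨i⟩
          exact (h2 ▸ spectrum.scalar_eq (α / 4) : spectrum ℝ _ = {α / 4}).subset h1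
        linarith [h4 i]

end Phi

/-! ### Residuals -/

section Residual

variable {N : ℕ} {M R R' : Matrix (Fin N) (Fin N) ℂ} {S : Finset (Fin N)}

/-- A characterization of the residual `M / S` of a psd matrix without a pseudoinverse: its rows
in `S` vanish, and it differs from `M` by a combination of the columns of `M` in `S`. -/
structure IsResidual (M : Matrix (Fin N) (Fin N) ℂ) (S : Finset (Fin N))
    (R : Matrix (Fin N) (Fin N) ℂ) : Prop where
  row_eq_zero : ∀ i ∈ S, ∀ j, R i j = 0
  exists_coeff : ∃ W : Matrix (Fin N) (Fin N) ℂ, (∀ i ∉ S, ∀ j, W i j = 0) ∧ M - R = M * W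

theorem mul_eq_zero_of_conj_eq_zero {m n : Type*} [Fintype m] [Fintype n]
    {M : Matrix m m ℂ} (hM : M.PosSemidef) {B : Matrix m n ℂ}
    (h : Bᴴ * M * B = 0) : M * B = 0 := by
  classical
  obtain ⟨C, rfl⟩ := CStarAlgebra.nonneg_iff_eq_star_mul_self.mp hM.nonneg
  rw [star_eq_conjTranspose] at h ⊢
  have : (C * B)ᴴ * (C * B) = 0 := by
    rw [conjTranspose_mul, ← h]
    simp only [Matrix.mul_assoc]
  rw [Matrix.mul_assoc, conjTranspose_mul_self_eq_zero.mp this, Matrix.mul_zero]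

/-- If the coefficients `W` are supported on the rows where `R` vanishes, then `W⋆ R = 0`. -/
theorem conjTranspose_mul_eq_zero_of_support {W : Matrix (Fin N) (Fin N) ℂ}
    (hW : ∀ i ∉ S, ∀ j, W i j = 0) (hR : ∀ i ∈ S, ∀ j, R i j = 0) : Wᴴ * R = 0 := by
  ext i j
  rw [mul_apply]
  refine Finset.sum_eq_zero fun k _ => ?_
  by_cases hk : k ∈ S
  · rw [hR k hk, mul_zero]
  · rw [conjTranspose_apply, hW k hk, star_zero, zero_mul]

theorem IsResidual.unique (hM : M.PosSemidef) (h : IsResidual M S R) (h' : IsResidual M S R') :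
    R = R' := by
  obtain ⟨W, hW, e⟩ := h.exists_coeff
  obtain ⟨W', hW', e'⟩ := h'.exists_coeff
  have hD : R - R' = M * (W' - W) := by rw [Matrix.mul_sub, ← e, ← e']; abel
  have h0 : (W' - W)ᴴ * (R - R') = 0 :=
    conjTranspose_mul_eq_zero_of_support (S := S)
      (fun i hi j => by rw [Matrix.sub_apply, hW i hi, hW' i hi, sub_zero])
      (fun i hi j => by rw [Matrix.sub_apply, h.row_eq_zero i hi, h'.row_eq_zero i hi, sub_zero])
  rw [hD, ← Matrix.mul_assoc] at h0
  rw [← sub_eq_zero, hD, mul_eq_zero_of_conj_eq_zero hM h0]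

theorem IsResidual.posSemidef (hM : M.PosSemidef) (h : IsResidual M S R) : R.PosSemidef := by
  obtain ⟨W, hW, e⟩ := h.exists_coeff
  have h0 := conjTranspose_mul_eq_zero_of_support hW h.row_eq_zero
  have hR : R = (1 - W)ᴴ * M * (1 - W) := by
    have h1 : M * (1 - W) = R := by rw [Matrix.mul_sub, ← e, Matrix.mul_one]; abel
    rw [Matrix.mul_assoc, h1, conjTranspose_sub, conjTranspose_one, Matrix.sub_mul, h0]
    simp
  rw [hR]
  exact hM.conjTranspose_mul_mul_same _

theorem IsResidual.le (hM : M.PosSemidef) (h : IsResidual M S R) : R ≤ M := by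
  obtain ⟨W, hW, e⟩ := h.exists_coeff
  have h0 := conjTranspose_mul_eq_zero_of_support hW h.row_eq_zero
  have hD : (M - R)ᴴ = M - R := (hM.isHermitian.sub (h.posSemidef hM).isHermitian).eq
  have h1 : M - R = Wᴴ * M * W := by
    have h2 : Wᴴ * M = M - R := by
      rw [← hD, e, conjTranspose_mul, hM.isHermitian.eq]
    calc M - R = Wᴴ * M := h2.symm
      _ = Wᴴ * (M - R) := by rw [Matrix.mul_sub, h0, sub_zero]
      _ = Wᴴ * M * W := by rw [e, Matrix.mul_assoc]
  rw [le_iff, h1]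
  exact hM.conjTranspose_mul_mul_same _

theorem isResidual_pivotResidual (hM : M.PosSemidef) (S : Finset (Fin N)) :
    IsResidual M S (pivotResidual M S) := by
  set f : S → Fin N := fun j => (j : Fin N) with hf
  set G := M.submatrix f f with hG
  set E : Matrix (Fin N) S ℂ := (1 : Matrix (Fin N) (Fin N) ℂ).submatrix id f with hE
  have hEH : Eᴴ = (1 : Matrix (Fin N) (Fin N) ℂ).submatrix f id := by
    rw [hE, conjTranspose_submatrix, conjTranspose_one]
  have hME : M.submatrix id f = M * E := by
    ext i j
    simp [hE, mul_apply, one_apply]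
  have hEM : M.submatrix f id = Eᴴ * M := by
    rw [hEH]
    ext i j
    simp [mul_apply, one_apply]
  have hGE : G = Eᴴ * M * E := by
    rw [← hEM]
    ext i j
    simp [hG, hE, mul_apply, one_apply]
  have hp := pinv_spec G
  have hres : pivotResidual M S = M - M * E * pinv G * (Eᴴ * M) := by
    rw [pivotResidual, ← hME, ← hEM]
  set Q : Matrix S S ℂ := 1 - G * pinv G with hQ
  have hQH : Qᴴ = Q := by rw [hQ, conjTranspose_sub, conjTranspose_one, hp.left_hermitian.eq]
  have hQG : Q * G = 0 := by
    rw [hQ, Matrix.sub_mul, Matrix.one_mul, hp.mul_mul_self, sub_self]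
  -- the columns of `M` in `S` lie in the range on which `G G†` acts as the identity
  have hMEQ : M * (E * Q) = 0 := by
    refine mul_eq_zero_of_conj_eq_zero hM ?_
    calc (E * Q)ᴴ * M * (E * Q) = Qᴴ * (Eᴴ * M * E) * Q := by
          rw [conjTranspose_mul]; simp only [Matrix.mul_assoc]
      _ = 0 := by rw [hQH, ← hGE, hQG, Matrix.zero_mul]
  have hrow : Eᴴ * pivotResidual M S = 0 := by
    have h1 : Q * (Eᴴ * M) = 0 := by
      have := congrArg conjTranspose hMEQ
      rwa [conjTranspose_mul, conjTranspose_mul, hQH, hM.isHermitian.eq, conjTranspose_zero,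
        Matrix.mul_assoc] at this
    rw [← h1, hres, hQ, Matrix.mul_sub, Matrix.sub_mul, Matrix.one_mul, hGE]
    simp only [Matrix.mul_assoc]
  refine ⟨fun i hi j => ?_, E * pinv G * (Eᴴ * M), fun i hi j => ?_, ?_⟩
  · have h1 := congrFun (congrFun hrow ⟨i, hi⟩) j
    rw [hEH, mul_apply] at h1
    simpa [one_apply, hf] using h1
  · rw [Matrix.mul_assoc, mul_apply]
    refine Finset.sum_eq_zero fun k _ => ?_
    have : i ≠ k := fun h => hi (h ▸ k.2)
    simp [hE, hf, one_apply, this]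
  · rw [hres, sub_sub_cancel]
    simp only [Matrix.mul_assoc]

theorem pivotResidual_eq (hM : M.PosSemidef) (h : IsResidual M S R) : pivotResidual M S = R :=
  (isResidual_pivotResidual hM S).unique hM h

theorem pivotResidual_posSemidef (hM : M.PosSemidef) (S : Finset (Fin N)) :
    (pivotResidual M S).PosSemidef :=
  (isResidual_pivotResidual hM S).posSemidef hM

theorem pivotResidual_empty (M : Matrix (Fin N) (Fin N) ℂ) : pivotResidual M ∅ = M := by
  rw [pivotResidual, sub_eq_self]
  ext i j
  rw [mul_apply]
  exact Finset.sum_eq_zero fun k _ => absurd k.2 (Finset.notMem_empty _)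

theorem diag_re_nonneg (hM : M.PosSemidef) (i : Fin N) : 0 ≤ (M i i).re :=
  (Complex.le_def.mp (hM.diag_nonneg (i := i))).1

theorem diag_eq_ofReal (hM : M.PosSemidef) (i : Fin N) : M i i = ((M i i).re : ℂ) :=
  (Complex.conj_eq_iff_re.mp (hM.isHermitian.apply i i)).symm

theorem diag_re_le {X Y : Matrix (Fin N) (Fin N) ℂ} (h : X ≤ Y) (i : Fin N) :
    (X i i).re ≤ (Y i i).re := by
  have := diag_re_nonneg (le_iff.mp h) i
  rw [Matrix.sub_apply, Complex.sub_re] at this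
  linarith

theorem col_eq_zero_of_diag_eq_zero (hM : M.PosSemidef) {s : Fin N} (h : (M s s).re = 0) (i : Fin N) :
    M i s = 0 := by
  have h0 : star (Pi.single s 1) ⬝ᵥ (M *ᵥ Pi.single s (1 : ℂ)) = 0 := by
    rw [mulVec_single_one, ← Pi.single_star, star_one, single_one_dotProduct, col_apply,
      diag_eq_ofReal hM, h, Complex.ofReal_zero]
  have := congrFun ((hM.dotProduct_mulVec_zero_iff _).mp h0) i
  simpa [mulVec_single_one, col_apply] using this

theorem row_eq_zero_of_diag_eq_zero (hM : M.PosSemidef) {s : Fin N} (h : (M s s).re = 0) (i : Fin N) :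
    M s i = 0 := by
  rw [← hM.isHermitian.apply, col_eq_zero_of_diag_eq_zero hM h, star_zero]

/-- Eliminating a further pivot `s` is a rank-one update. For `(M / S)(s, s) = 0` the update is
void, in agreement with division by zero. -/
theorem pivotResidual_insert (hM : M.PosSemidef) (S : Finset (Fin N)) (s : Fin N) :
    pivotResidual M (insert s S) = pivotResidual M S
      - (pivotResidual M S s s).re⁻¹ •
        (pivotResidual M S * single s s 1 * pivotResidual M S) := by
  have hres := isResidual_pivotResidual hM S
  have hps := hres.posSemidef hM
  set R := pivotResidual M S
  obtain ⟨W, hW, e⟩ := hres.exists_coeff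
  set c : ℂ := (((R s s).re⁻¹ : ℝ) : ℂ) with hc
  have hent : ∀ i j, (R - (R s s).re⁻¹ • (R * single s s 1 * R) : Matrix _ _ ℂ) i j
      = R i j - c * (R i s * R s j) := by
    intro i j
    rw [Matrix.sub_apply, Matrix.smul_apply, Complex.real_smul, ← hc, mul_assoc R, mul_apply]
    congr 2
    rw [Finset.sum_eq_single s]
    · simp
    · intro k _ hk
      simp [hk]
    · simp
  refine pivotResidual_eq hM ⟨fun i hi j => ?_, ?_⟩
  · rw [hent]
    rcases Finset.mem_insert.mp hi with rfl | hi
    · by_cases h0 : (R i i).re = 0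
      · rw [row_eq_zero_of_diag_eq_zero hps h0, row_eq_zero_of_diag_eq_zero hps h0]; simp
      · rw [diag_eq_ofReal hps i, hc]
        have : ((R i i).re : ℂ) ≠ 0 := by exact_mod_cast h0
        push_cast
        field_simp
        simp
    · rw [hres.row_eq_zero i hi, hres.row_eq_zero i hi]; simp
  · -- `M - R = M W` and `R = M (1 - W)`
    refine ⟨W + c • ((1 - W) * single s s 1 * R), fun i hi j => ?_, ?_⟩
    · rw [Finset.mem_insert, not_or] at hi
      rw [Matrix.add_apply, hW i hi.2, Matrix.smul_apply, mul_assoc, mul_apply, zero_add,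
        Finset.sum_eq_zero fun k _ => ?_, smul_zero]
      by_cases hk : k = s
      · rw [hk, Matrix.sub_apply, one_apply_ne hi.1, hW i hi.2, sub_zero, zero_mul]
      · simp [mul_apply, Ne.symm hk]
    · have h1 : M * (1 - W) = R := by rw [Matrix.mul_sub, ← e, Matrix.mul_one]; abel
      rw [Matrix.mul_add, ← e, Matrix.mul_smul, ← Matrix.mul_assoc, ← Matrix.mul_assoc, h1, hc,
        Complex.coe_smul]
      abel

end Residual

/-! ### Joint concavity of `(α, X) ↦ X - X² / α` -/

section Convexity

variable {N : ℕ}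

theorem phi_ofReal (α : ℝ) (X : Matrix (Fin N) (Fin N) ℂ) : phi (α : ℂ) X = X - α⁻¹ • X ^ 2 := by
  rw [phi, one_div, ← Complex.ofReal_inv, Complex.coe_smul]

theorem sq_nonneg_of_isHermitian {X : Matrix (Fin N) (Fin N) ℂ} (hX : X.IsHermitian) :
    0 ≤ X ^ 2 := by
  rw [nonneg_iff_posSemidef, sq]
  nth_rewrite 1 [← hX.eq]
  exact posSemidef_conjTranspose_mul_self X

/-- Jensen's inequality for `(α, X) ↦ phi α X`. The difference of the two sides is
`∑ i, w i * α i * (X i / α i - (∑ w X) / (∑ w α))²`. -/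
theorem sum_smul_phi_le {ι : Type*} (s : Finset ι) {w α : ι → ℝ}
    {X : ι → Matrix (Fin N) (Fin N) ℂ} (hw : ∀ i ∈ s, 0 ≤ w i * α i)
    (h0 : ∀ i ∈ s, α i = 0 → X i = 0)
    (hH : ∀ i ∈ s, (X i).IsHermitian) :
    ∑ i ∈ s, w i • phi (α i : ℂ) (X i)
      ≤ phi ((∑ i ∈ s, w i * α i : ℝ) : ℂ) (∑ i ∈ s, w i • X i) := by
  set c := ∑ i ∈ s, w i * α i with hc
  set Y := ∑ i ∈ s, w i • X i with hY
  have hsmul : ∀ (r : ℝ) {Z : Matrix (Fin N) (Fin N) ℂ}, Z.IsHermitian → (r • Z).IsHermitian :=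
    fun r Z hZ => by rw [IsHermitian, conjTranspose_smul, hZ.eq, star_trivial]
  have hYH : Y.IsHermitian := by
    rw [IsHermitian, hY, conjTranspose_sum]
    exact Finset.sum_congr rfl fun i hi => (hsmul (w i) (hH i hi)).eq
  have key : phi (c : ℂ) Y - ∑ i ∈ s, w i • phi (α i : ℂ) (X i)
      = ∑ i ∈ s, (w i * α i) • ((α i)⁻¹ • X i - c⁻¹ • Y) ^ 2 := by
    have hterm : ∀ i ∈ s, (w i * α i) • ((α i)⁻¹ • X i - c⁻¹ • Y) ^ 2
        = w i • X i - w i • phi (α i : ℂ) (X i) - c⁻¹ • ((w i • X i) * Y)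
          - c⁻¹ • (Y * (w i • X i)) + (w i * α i) • (c⁻¹ ^ 2 • Y ^ 2) := by
      intro i hi
      by_cases h : α i = 0
      · rw [h0 i hi h, h]
        simp [phi]
      · obtain ⟨β, hβ⟩ : ∃ β, β = (α i)⁻¹ := ⟨_, rfl⟩
        obtain ⟨v, hv⟩ : ∃ v, v = w i * α i := ⟨_, rfl⟩
        have hwv : w i = v * β := by rw [hv, hβ, mul_inv_cancel_right₀ h]
        rw [phi_ofReal, ← hβ, ← hv, hwv, sq, sub_mul, mul_sub, mul_sub]
        simp only [smul_mul_assoc, mul_smul_comm, ← sq, smul_pow]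
        module
    rw [Finset.sum_congr rfl hterm, Finset.sum_add_distrib, Finset.sum_sub_distrib,
      Finset.sum_sub_distrib, Finset.sum_sub_distrib, ← Finset.smul_sum, ← Finset.smul_sum,
      ← Finset.sum_mul, ← Finset.mul_sum, ← Finset.sum_smul, ← hY, ← hc, phi_ofReal, smul_smul,
      ← sq Y]
    have h2 : c * c⁻¹ ^ 2 = c⁻¹ := by
      by_cases h : c = 0
      · simp [h]
      · field_simp
    rw [h2]
    abel
  rw [← sub_nonneg, key]
  exact Finset.sum_nonneg fun i hi => smul_nonneg (hw i hi)
    (sq_nonneg_of_isHermitian ((hsmul _ (hH i hi)).sub (hsmul _ hYH)))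

end Convexity

/-! ### Expectations under laws of finite support -/

section Expectation

variable {α β E : Type} [AddCommGroup E] [TopologicalSpace E] [Module ℝ E]

theorem expectation_eq_sum {p : PMF α} {s : Finset α} (hs : p.support ⊆ s) (f : α → E) :
    expectation p f = ∑ a ∈ s, (p a).toReal • f a := by
  refine tsum_eq_sum fun a ha => ?_
  rw [(PMF.apply_eq_zero_iff p a).mpr fun h => ha (hs h), ENNReal.toReal_zero, zero_smul]

theorem expectation_eq_sum_univ [Fintype α] (p : PMF α) (f : α → E) :
    expectation p f = ∑ a, (p a).toReal • f a :=
  tsum_fintype _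

theorem expectation_pure (a : α) (f : α → E) : expectation (PMF.pure a) f = f a := by
  rw [expectation_eq_sum (s := {a}) (by simp)]
  simp

theorem sum_toReal_eq_one [Fintype α] (p : PMF α) : ∑ a, (p a).toReal = 1 := by
  have h : ∑' a, p a = ∑ a, p a := tsum_fintype _
  rw [← ENNReal.toReal_sum fun a _ => p.apply_ne_top a, ← h, p.tsum_coe, ENNReal.toReal_one]

theorem expectation_bind {p : PMF α} {q : α → PMF β} (hp : p.support.Finite)
    (hq : ∀ a, (q a).support.Finite) (f : β → E) :
    expectation (p.bind q) f = expectation p fun a => expectation (q a) f := by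
  set s := hp.toFinset
  have hs : p.support ⊆ s := hp.coe_toFinset.ge
  set T := (support_bind_finite hp hq).toFinset
  have hT : (p.bind q).support ⊆ T := (support_bind_finite hp hq).coe_toFinset.ge
  have hqT : ∀ a ∈ s, (q a).support ⊆ T := fun a ha => by
    refine subset_trans ?_ hT
    rw [PMF.support_bind]
    exact Set.subset_biUnion_of_mem (u := fun a => (q a).support) (hp.mem_toFinset.mp ha)
  have hbind : ∀ b, ((p.bind q) b).toReal = ∑ a ∈ s, (p a).toReal * (q a b).toReal := fun b => by
    rw [PMF.bind_apply, tsum_eq_sum (s := s), ENNReal.toReal_sum]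
    · exact Finset.sum_congr rfl fun a _ => ENNReal.toReal_mul
    · exact fun a _ => ENNReal.mul_ne_top (p.apply_ne_top a) ((q a).apply_ne_top b)
    · intro a ha
      rw [(PMF.apply_eq_zero_iff p a).mpr fun h => ha (hs h), zero_mul]
  rw [expectation_eq_sum hT, expectation_eq_sum hs]
  simp_rw [hbind, Finset.sum_smul]
  rw [Finset.sum_comm]
  refine Finset.sum_congr rfl fun a ha => ?_
  rw [expectation_eq_sum (hqT a ha), Finset.smul_sum]
  exact Finset.sum_congr rfl fun b _ => mul_smul _ _ _

theorem expectation_map {p : PMF α} (g : α → β) (hp : p.support.Finite) (f : β → E) :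
    expectation (p.map g) f = expectation p (f ∘ g) := by
  rw [PMF.map, expectation_bind hp fun a => by simp]
  simp_rw [Function.comp_apply, expectation_pure]
  rfl

end Expectation

/-! ### The selection of pivots as a Markov chain -/

section Pivots

variable {N : ℕ}

/-- The law of the pivot set after the proposal `s` has been treated, given the pivots `S` that
have been accepted before: block RPCholesky always accepts. -/
def treatProposal (μ : Method) (M : Matrix (Fin N) (Fin N) ℂ) (S : Finset (Fin N)) (s : Fin N) :
    PMF (Finset (Fin N)) :=
  match μ with
  | .block => PMF.pure (insert s S)
  | .accelerated => (acceptCoin M S s).map fun a => if a then insert s S else S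

/-- The law of the pivot set after a list of proposals has been treated, starting from `S`. -/
def treatProposals (μ : Method) (M : Matrix (Fin N) (Fin N) ℂ) :
    List (Fin N) → Finset (Fin N) → PMF (Finset (Fin N))
  | [], S => PMF.pure S
  | s :: l, S => (treatProposal μ M S s).bind (treatProposals μ M l)

theorem selectPivots_eq_treatProposals (μ : Method) (M : Matrix (Fin N) (Fin N) ℂ)
    (l : List (Fin N)) : selectPivots μ M l = treatProposals μ M l ∅ := by
  cases μ with
  | block =>
    have h : ∀ S, treatProposals .block M l S = PMF.pure (l.toFinset ∪ S) := by
      induction l with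
      | nil => intro S; simp [treatProposals]
      | cons s l ih =>
        intro S
        rw [treatProposals, treatProposal, PMF.pure_bind, ih, List.toFinset_cons,
          Finset.union_insert, Finset.insert_union]
    rw [h, Finset.union_empty, selectPivots]
  | accelerated =>
    have h : ∀ S, treatProposals .accelerated M l S = rejectionSample M l S := by
      induction l with
      | nil => intro S; rfl
      | cons s l ih =>
        intro S
        rw [treatProposals, treatProposal, PMF.map, PMF.bind_bind, rejectionSample]
        simp [ih]
    rw [h, selectPivots]

/-- One step of the chain of pivot sets: draw a proposal and treat it. -/
def pivotStep (μ : Method) (M : Matrix (Fin N) (Fin N) ℂ) (S : Finset (Fin N)) :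
    PMF (Finset (Fin N)) :=
  if h : ∑' j, diagWeight M j = 0 then PMF.pure S
  else (proposal M h).bind (treatProposal μ M S)

/-- The law of the pivot set after `b` steps, starting from `S`. -/
def pivotLaw (μ : Method) (M : Matrix (Fin N) (Fin N) ℂ) (S : Finset (Fin N)) :
    ℕ → PMF (Finset (Fin N))
  | 0 => PMF.pure S
  | b + 1 => (pivotLaw μ M S b).bind (pivotStep μ M)

theorem pivotLaw_succ' (μ : Method) (M : Matrix (Fin N) (Fin N) ℂ) (S : Finset (Fin N)) (b : ℕ) :
    pivotLaw μ M S (b + 1) = (pivotStep μ M S).bind fun T => pivotLaw μ M T b := by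
  induction b with
  | zero => simp [pivotLaw]
  | succ b ih =>
    rw [pivotLaw, ih, PMF.bind_bind]
    rfl

theorem iidDraws_bind_treatProposals (μ : Method) (M : Matrix (Fin N) (Fin N) ℂ)
    (h : ∑' j, diagWeight M j ≠ 0) (b : ℕ) (S : Finset (Fin N)) :
    ((iidDraws (proposal M h) b).bind fun l => treatProposals μ M l S) = pivotLaw μ M S b := by
  induction b generalizing S with
  | zero => simp [iidDraws, treatProposals, pivotLaw]
  | succ b ih =>
    rw [pivotLaw_succ', pivotStep, dif_neg h, iidDraws, PMF.bind_bind, PMF.bind_bind]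
    congr 1
    funext s
    simp only [PMF.map, PMF.bind_bind, Function.comp_apply, PMF.pure_bind, treatProposals]
    rw [PMF.bind_comm]
    simp_rw [ih]

theorem roundLaw_eq_map_pivotLaw (μ : Method) (b : ℕ) (M : Matrix (Fin N) (Fin N) ℂ) :
    roundLaw μ b M = (pivotLaw μ M ∅ b).map (pivotResidual M) := by
  by_cases h : ∑' j, diagWeight M j = 0
  · have h1 : pivotLaw μ M ∅ b = PMF.pure ∅ := by
      induction b with
      | zero => rfl
      | succ b ih => rw [pivotLaw, ih, PMF.pure_bind, pivotStep, dif_pos h]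
    rw [h1, PMF.pure_map, pivotResidual_empty, roundLaw, dif_pos h]
  · rw [roundLaw, dif_neg h, ← iidDraws_bind_treatProposals μ M h]
    simp_rw [← selectPivots_eq_treatProposals]

end Pivots

/-! ### One step of the chain -/

section Step

variable {N : ℕ} {M : Matrix (Fin N) (Fin N) ℂ}

theorem trace_eq_ofReal (hM : M.PosSemidef) : M.trace = (M.trace.re : ℂ) := by
  rw [trace_eq_ofReal_sum hM.isHermitian, Complex.ofReal_re]

theorem trace_re_nonneg (hM : M.PosSemidef) : 0 ≤ M.trace.re :=
  (Complex.le_def.mp hM.trace_nonneg).1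

theorem tsum_diagWeight (hM : M.PosSemidef) :
    ∑' j, diagWeight M j = ENNReal.ofReal M.trace.re := by
  rw [tsum_fintype, trace, Complex.re_sum, ENNReal.ofReal_sum_of_nonneg]
  · rfl
  · exact fun i _ => diag_re_nonneg hM i

theorem toReal_proposal (hM : M.PosSemidef) (h : ∑' j, diagWeight M j ≠ 0) (s : Fin N) :
    (proposal M h s).toReal = (M s s).re / M.trace.re := by
  rw [proposal, PMF.normalize_apply, tsum_diagWeight hM, diagWeight, ENNReal.toReal_mul,
    ENNReal.toReal_inv, ENNReal.toReal_ofReal (diag_re_nonneg hM s),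
    ENNReal.toReal_ofReal (trace_re_nonneg hM), div_eq_mul_inv]

theorem treatProposal_support_finite (μ : Method) (S : Finset (Fin N)) (s : Fin N) :
    (treatProposal μ M S s).support.Finite :=
  Set.toFinite _

/-- The expected residual after treating the proposal `s`. The witness `q` is the probability of
accepting `s`, which is at least `(M / S)(s, s) / M(s, s)`. -/
theorem exists_expectation_treatProposal (hM : M.PosSemidef) (μ : Method) (S : Finset (Fin N))
    (s : Fin N) : ∃ q : ℝ, (pivotResidual M S s s).re ≤ q * (M s s).re ∧
      expectation (treatProposal μ M S s) (pivotResidual M)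
        = pivotResidual M S - (q * (pivotResidual M S s s).re⁻¹) •
          (pivotResidual M S * single s s 1 * pivotResidual M S) := by
  have hle := diag_re_le ((isResidual_pivotResidual hM S).le hM) s
  have hR0 := diag_re_nonneg (pivotResidual_posSemidef hM S) s
  cases μ with
  | block =>
    refine ⟨1, by rwa [one_mul], ?_⟩
    rw [treatProposal, expectation_pure, pivotResidual_insert hM, one_mul]
  | accelerated =>
    set q := (pivotResidual M S s s).re / (M s s).re with hq
    have hM0 := diag_re_nonneg hM s
    have hq0 : 0 ≤ q := div_nonneg hR0 hM0
    have hq1 : q ≤ 1 := div_le_one_of_le₀ hle hM0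
    have hprob : acceptProb M S s = ENNReal.ofReal q :=
      min_eq_right (ENNReal.ofReal_le_one.mpr hq1)
    refine ⟨q, ?_, ?_⟩
    · rcases hM0.eq_or_lt with h | h
      · rw [← h] at hle ⊢; linarith
      · rw [hq, div_mul_cancel₀ _ h.ne']
    · rw [treatProposal, expectation_map _ (Set.toFinite _),
        expectation_eq_sum_univ, Fintype.sum_bool]
      have ht : (acceptCoin M S s true).toReal = q := by
        rw [acceptCoin, PMF.ofFintype_apply, if_pos rfl, hprob, ENNReal.toReal_ofReal hq0]
      have hf : (acceptCoin M S s false).toReal = 1 - q := by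
        rw [acceptCoin, PMF.ofFintype_apply, if_neg (by simp), hprob,
          ENNReal.toReal_sub_of_le (ENNReal.ofReal_le_one.mpr hq1) ENNReal.one_ne_top,
          ENNReal.toReal_ofReal hq0, ENNReal.toReal_one]
      rw [ht, hf]
      simp only [Function.comp_apply, if_true, Bool.false_eq_true, if_false,
        pivotResidual_insert hM]
      module

/-- One step decreases the expected residual at least as much as `phi`. For accelerated
RPCholesky this is an equality; block RPCholesky decreases it more. -/
theorem expectation_pivotStep_le (hM : M.PosSemidef) (μ : Method) (S : Finset (Fin N)) :
    expectation (pivotStep μ M S) (pivotResidual M) ≤ phi M.trace (pivotResidual M S) := by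
  set R := pivotResidual M S with hR
  have hps := pivotResidual_posSemidef hM S
  rw [← hR] at hps
  by_cases h : ∑' j, diagWeight M j = 0
  · rw [pivotStep, dif_pos h, expectation_pure]
    rw [tsum_diagWeight hM, ENNReal.ofReal_eq_zero] at h
    rw [trace_eq_ofReal hM, le_antisymm h (trace_re_nonneg hM), phi]
    simp [hR]
  · have hα : 0 < M.trace.re := by
      rwa [tsum_diagWeight hM, ENNReal.ofReal_eq_zero, not_le] at h
    have hsum : ∑ s, (proposal M h s).toReal = 1 := sum_toReal_eq_one _
    have hsq : R ^ 2 = ∑ s, R * single s s 1 * R := by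
      have h1 : ∑ s, single s s (1 : ℂ) = (1 : Matrix (Fin N) (Fin N) ℂ) := by
        ext i j
        rw [Matrix.sum_apply, Finset.sum_eq_single i (fun k _ hk => by simp [hk]) (by simp)]
        by_cases hij : i = j
        · simp [hij, one_apply]
        · simp [hij, one_apply]
      rw [← Finset.sum_mul, ← Finset.mul_sum, h1, Matrix.mul_one, sq]
    rw [pivotStep, dif_neg h, expectation_bind (Set.toFinite _)
        (treatProposal_support_finite μ S), expectation_eq_sum_univ,
      trace_eq_ofReal hM, phi_ofReal, hsq, Finset.smul_sum]
    have hR1 : R = ∑ s, (proposal M h s).toReal • R := by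
      rw [← Finset.sum_smul, hsum, one_smul]
    conv_rhs => lhs; rw [hR1]
    rw [← Finset.sum_sub_distrib]
    refine Finset.sum_le_sum fun s _ => ?_
    obtain ⟨q, hq, e⟩ := exists_expectation_treatProposal hM μ S s
    rw [← hR] at hq e
    rw [e, smul_sub, smul_smul, toReal_proposal hM]
    refine sub_le_sub_left ?_ _
    by_cases h0 : (R s s).re = 0
    · have : R * single s s 1 = 0 := by
        ext i j
        rw [mul_apply]
        refine Finset.sum_eq_zero fun k _ => ?_
        by_cases hk : k = s
        · rw [hk, col_eq_zero_of_diag_eq_zero hps h0, zero_mul]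
        · simp [Ne.symm hk]
      simp [this]
    · have hRpos : 0 < (R s s).re := lt_of_le_of_ne (diag_re_nonneg hps s) (Ne.symm h0)
      refine smul_le_smul_of_nonneg_right ?_ ?_
      · rw [← div_eq_mul_inv, div_mul_div_comm, inv_eq_one_div, div_le_div_iff₀ hα (by positivity)]
        nlinarith
      · have h1 : (single s s (1 : ℂ)).PosSemidef := by
          have : single s s (1 : ℂ) = diagonal (Pi.single s 1) := by
            rw [diagonal_single]
          rw [this]
          refine PosSemidef.diagonal fun i => ?_
          by_cases hi : i = s
          · rw [hi]; simp
          · simp [hi]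
        have := h1.conjTranspose_mul_mul_same R
        rw [hps.isHermitian.eq] at this
        exact this.nonneg

end Step

/-! ### The expected residuals of a round -/

section Round

variable {N : ℕ}

/-- The expected residual after `k` steps of a round that starts from `M`. -/
def stepMean (μ : Method) (M : Matrix (Fin N) (Fin N) ℂ) (k : ℕ) : Matrix (Fin N) (Fin N) ℂ :=
  expectation (pivotLaw μ M ∅ k) (pivotResidual M)

theorem sum_smul_posSemidef {ι : Type*} {s : Finset ι} {w : ι → ℝ}
    {X : ι → Matrix (Fin N) (Fin N) ℂ} (hw : ∀ i ∈ s, 0 ≤ w i) (hX : ∀ i ∈ s, (X i).PosSemidef) :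
    (∑ i ∈ s, w i • X i).PosSemidef :=
  (Finset.sum_nonneg fun i hi => smul_nonneg (hw i hi) (hX i hi).nonneg).posSemidef

theorem expectation_posSemidef {α : Type} {p : PMF α} (hp : p.support.Finite)
    {f : α → Matrix (Fin N) (Fin N) ℂ} (hf : ∀ a ∈ p.support, (f a).PosSemidef) :
    (expectation p f).PosSemidef := by
  rw [expectation_eq_sum hp.coe_toFinset.ge]
  exact sum_smul_posSemidef (fun _ _ => ENNReal.toReal_nonneg)
    fun a ha => hf a (hp.mem_toFinset.mp ha)

variable {M : Matrix (Fin N) (Fin N) ℂ}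

theorem stepMean_posSemidef (hM : M.PosSemidef) (μ : Method) (k : ℕ) :
    (stepMean μ M k).PosSemidef :=
  expectation_posSemidef (Set.toFinite _) fun S _ => pivotResidual_posSemidef hM S

theorem stepMean_zero (μ : Method) (M : Matrix (Fin N) (Fin N) ℂ) : stepMean μ M 0 = M := by
  rw [stepMean, pivotLaw, expectation_pure, pivotResidual_empty]

theorem stepMean_of_trace_eq_zero (hM : M.PosSemidef) (h : M.trace.re = 0) (μ : Method) (k : ℕ) :
    stepMean μ M k = 0 := by
  have h0 : M = 0 := by
    rw [← hM.trace_eq_zero_iff, trace_eq_ofReal hM, h, Complex.ofReal_zero]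
  have h1 : ∀ S, pivotResidual M S = 0 := fun S => by
    rw [pivotResidual, h0]
    simp
  rw [stepMean, expectation_eq_sum_univ]
  simp [h1]

theorem stepMean_succ_le (hM : M.PosSemidef) (μ : Method) (k : ℕ) :
    stepMean μ M (k + 1) ≤ phi M.trace (stepMean μ M k) := by
  rw [stepMean, pivotLaw, expectation_bind (Set.toFinite _) fun _ => Set.toFinite _,
    expectation_eq_sum_univ]
  refine (Finset.sum_le_sum fun S _ => smul_le_smul_of_nonneg_left
    (expectation_pivotStep_le hM μ S) ENNReal.toReal_nonneg).trans ?_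
  by_cases h : M.trace.re = 0
  · rw [stepMean, expectation_eq_sum_univ, trace_eq_ofReal hM, h]
    simp [phi]
  have hsum : ∑ S, (pivotLaw μ M ∅ k S).toReal = 1 := sum_toReal_eq_one _
  have := sum_smul_phi_le Finset.univ (w := fun S => (pivotLaw μ M ∅ k S).toReal)
    (α := fun _ => M.trace.re) (X := pivotResidual M)
    (fun S _ => mul_nonneg ENNReal.toReal_nonneg (trace_re_nonneg hM))
    (fun _ _ h0 => absurd h0 h) (fun S _ => (pivotResidual_posSemidef hM S).isHermitian)
  rwa [← Finset.sum_mul, hsum, one_mul, ← trace_eq_ofReal hM, ← expectation_eq_sum_univ _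
    (pivotResidual M)] at this

end Round

/-! ### The law of the residual after several rounds -/

section Law

variable {N : ℕ} {A : Matrix (Fin N) (Fin N) ℂ}

theorem roundLaw_support_finite (μ : Method) (b : ℕ) (M : Matrix (Fin N) (Fin N) ℂ) :
    (roundLaw μ b M).support.Finite := by
  rw [roundLaw_eq_map_pivotLaw, PMF.support_map]
  exact (Set.toFinite _).image _

theorem posSemidef_of_mem_support_residualLaw (hA : A.PosSemidef) (μ : Method) (b t : ℕ) :
    ∀ M ∈ (residualLaw μ b A t).support, M.PosSemidef := by
  induction t with
  | zero =>
    intro M hM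
    rw [residualLaw, PMF.mem_support_pure_iff] at hM
    rwa [hM]
  | succ t ih =>
    intro M hM
    rw [residualLaw, PMF.mem_support_bind_iff] at hM
    obtain ⟨L, hL, hM⟩ := hM
    rw [roundLaw_eq_map_pivotLaw, PMF.mem_support_map_iff] at hM
    obtain ⟨S, -, rfl⟩ := hM
    exact pivotResidual_posSemidef (ih L hL) S

theorem expectation_residualLaw_posSemidef (hA : A.PosSemidef) (μ : Method) (b t : ℕ) :
    (expectation (residualLaw μ b A t) id).PosSemidef :=
  expectation_posSemidef (residualLaw_support_finite μ b A t)
    (posSemidef_of_mem_support_residualLaw hA μ b t)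

theorem expectation_trace_re {p : PMF (Matrix (Fin N) (Fin N) ℂ)} (hp : p.support.Finite) :
    expectation p (fun M => M.trace.re) = (expectation p id).trace.re := by
  rw [expectation_eq_sum hp.coe_toFinset.ge, expectation_eq_sum hp.coe_toFinset.ge, trace_sum,
    Complex.re_sum]
  refine Finset.sum_congr rfl fun M _ => ?_
  rw [trace_smul, Complex.smul_re, id]

theorem eigenvalues_congr {X Y : Matrix (Fin N) (Fin N) ℂ} (h : X = Y) (hX : X.IsHermitian)
    (hY : Y.IsHermitian) : hX.eigenvalues = hY.eigenvalues := by
  subst h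
  rfl

/-- A round acts on the eigenvalues of the expected residual at least as much as `Phi`. -/
theorem eigenvalues_expectation_residualLaw_succ_le (hA : A.PosSemidef) (μ : Method) (b t : ℕ) :
    (expectation_residualLaw_posSemidef hA μ b (t + 1)).isHermitian.eigenvalues
      ≤ (Phi_posSemidef (expectation_residualLaw_posSemidef hA μ b t) b).isHermitian.eigenvalues := by
  have hfin := residualLaw_support_finite μ b A t
  have hpsd := posSemidef_of_mem_support_residualLaw hA μ b t
  set p := residualLaw μ b A t with hp
  set s := hfin.toFinset
  have hs : p.support ⊆ s := hfin.coe_toFinset.ge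
  have hM : ∀ M ∈ s, M.PosSemidef := fun M h => hpsd M (hfin.mem_toFinset.mp h)
  set X : ℕ → Matrix (Fin N) (Fin N) ℂ := fun k => expectation p fun M => stepMean μ M k with hX
  have hX0 : X 0 = expectation p id := by simp only [hX, stepMean_zero]; rfl
  have hXb : X b = expectation (residualLaw μ b A (t + 1)) id := by
    rw [residualLaw, expectation_bind hfin (roundLaw_support_finite μ b)]
    simp only [hX, roundLaw_eq_map_pivotLaw]
    congr 1
    funext M
    rw [expectation_map _ (Set.toFinite _)]
    rfl
  have hXpsd : ∀ k, (X k).PosSemidef := fun k =>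
    expectation_posSemidef hfin fun M h => stepMean_posSemidef (hpsd M h) μ k
  have hstep : ∀ k, X (k + 1) ≤ phi (X 0).trace (X k) := fun k => by
    have htr : (X 0).trace = ((∑ M ∈ s, (p M).toReal * M.trace.re : ℝ) : ℂ) := by
      rw [trace_eq_ofReal (hXpsd 0), hX0, ← expectation_trace_re hfin, expectation_eq_sum hs]
      rfl
    rw [htr]
    simp only [hX, expectation_eq_sum hs]
    refine le_trans (Finset.sum_le_sum fun M h => ?_) (sum_smul_phi_le s
      (fun M h => mul_nonneg ENNReal.toReal_nonneg (trace_re_nonneg (hM M h)))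
      (fun M h h0 => stepMean_of_trace_eq_zero (hM M h) h0 μ k)
      fun M h => (stepMean_posSemidef (hM M h) μ k).isHermitian)
    rw [← trace_eq_ofReal (hM M h)]
    exact smul_le_smul_of_nonneg_left (stepMean_succ_le (hM M h) μ k) ENNReal.toReal_nonneg
  have := eigenvalues_le_eigenvalues_Phi (fun k => (hXpsd k).isHermitian) (hXpsd 0) hstep b
  rwa [eigenvalues_congr hXb _ (expectation_residualLaw_posSemidef hA μ b (t + 1)).isHermitian,
    eigenvalues_congr (congrArg (Phi b) hX0) _
      (Phi_posSemidef (expectation_residualLaw_posSemidef hA μ b t) b).isHermitian] at this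

theorem eigenvalues_expectation_residualLaw_le (hA : A.PosSemidef) (μ : Method) (b t : ℕ) :
    (expectation_residualLaw_posSemidef hA μ b t).isHermitian.eigenvalues
      ≤ (iterate_Phi_posSemidef hA b t).isHermitian.eigenvalues := by
  induction t with
  | zero =>
    have h : expectation (residualLaw μ b A 0) id = A := expectation_pure _ _
    exact (eigenvalues_congr h _ hA.isHermitian).le
  | succ t ih =>
    have h := (eigenvalues_expectation_residualLaw_succ_le hA μ b t).trans
      (eigenvalues_Phi_le_eigenvalues_Phi
      (expectation_residualLaw_posSemidef hA μ b t) (iterate_Phi_posSemidef hA b t) ih b)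
    rwa [eigenvalues_congr (Function.iterate_succ_apply' (Phi b) t A).symm _
      (iterate_Phi_posSemidef hA b (t + 1)).isHermitian] at h

end Law

end RPCholesky

end

theorem mainTheorem3 {N : ℕ} (A : Matrix (Fin N) (Fin N) ℂ) (hA : A.PosSemidef)
    (b : ℕ) (hb : 1 ≤ b) (t : ℕ) (μ : RPCholesky.Method) :
    (∃ (hE : (RPCholesky.expectation (RPCholesky.residualLaw μ b A t) id).PosSemidef)
        (hΦ : ((RPCholesky.Phi b)^[t] A).PosSemidef),
        ∀ i : Fin N, RPCholesky.orderedEigenvalue hE.isHermitian i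
          ≤ RPCholesky.orderedEigenvalue hΦ.isHermitian i) ∧
      RPCholesky.expectation (RPCholesky.residualLaw μ b A t) (fun M => M.trace.re)
        ≤ ((RPCholesky.Phi b)^[t] A).trace.re := by
  have hE := RPCholesky.expectation_residualLaw_posSemidef hA μ b t
  have hΦ := RPCholesky.iterate_Phi_posSemidef hA b t
  have hle : hE.isHermitian.eigenvalues ≤ hΦ.isHermitian.eigenvalues :=
    RPCholesky.eigenvalues_expectation_residualLaw_le hA μ b t
  refine ⟨⟨hE, hΦ, fun i => ?_⟩, ?_⟩
  · -- `eigenvalues` is the decreasing list `eigenvalues₀` in a fixed enumeration of the indices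
    have := hle (Fintype.equivOfCardEq (Fintype.card_fin _)
      (Fin.cast (Fintype.card_fin N).symm i))
    simpa only [Matrix.IsHermitian.eigenvalues, Equiv.symm_apply_apply] using! this
  · rw [RPCholesky.expectation_trace_re (RPCholesky.residualLaw_support_finite μ b A t),
      RPCholesky.trace_eq_ofReal_sum hE.isHermitian, RPCholesky.trace_eq_ofReal_sum hΦ.isHermitian,
      Complex.ofReal_re, Complex.ofReal_re]
    exact Finset.sum_le_sum fun i _ => hle i
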